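/- All graphs are finite and simple. A $k$-cover $H$ of a graph $G=(V,E)$ consists of a set $\Gamma$ of colors, a list $L(v)\subseteq\Gamma$ with $|L(v)|=k$ for every $v\in V$, and, for every edge $uv\in E$, a (not necessarily perfect) matching $M(uv)$ in the complete bipartite graph with parts $\{u\}\times L(u)$ and $\{v\}\times L(v)$; regard $H$ as the graph with vertex set $\bigcup_{v\in V}\{v\}\times L(v)$ and edge set $\bigcup_{uv\in E}M(uv)$. An $H$-coloring of $G$ is a function $f:V\to\Gamma$ with $f(v)\in L(v)$ for all $v\in V$ such that $\{(v,f(v)):v\in V\}$ is independent in $H$. The graph $G$ is strongly equitably DP $k$-colorable if for every $k$-cover $H$ of $G$ there is an $H$-coloring $f$ such that every color class $f^{-1}(\alpha)$, $\alpha\in\Gamma$, has at most $\lceil |V|/k\rceil$ vertices and at most $|V| \bmod k$ of the color classes have exactly $\lfloor |V|/k\rfloor+1$ vertices. Corollary 4.4. Let $P_t=v_1\dots v_t$ be the path with $t$ vertices. If $t\ne 3$, then $P_t$ is strongly equitably DP $k$-colorable for every $k\ge 3$. -/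

import Mathlib

universe w

/-- A cover `H` of a graph `G`, with colors in `Γ`: a finite list of colors `list v` for every
vertex `v`, and for every edge `uv` of `G` a matching between the nodes `{u} × list u` and
`{v} × list v`; the edges of the cover graph are exactly the edges of these matchings.
The nodes of the cover are the pairs `(v, γ)` with `γ ∈ list v`; the remaining pairs in `V × Γ`
are isolated in `graph` and play no role. -/
structure DPCover {V : Type*} (G : SimpleGraph V) (Γ : Type*) where
  /-- the list assignment -/
  list : V → Finset Γ
  /-- the cover graph -/
  graph : SimpleGraph (V × Γ)
  /-- edges join nodes (for the other end use symmetry of `graph`) -/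
  mem_list : ∀ x y, graph.Adj x y → x.2 ∈ list x.1
  /-- edges lie over edges of `G` -/
  adj_base : ∀ x y, graph.Adj x y → G.Adj x.1 y.1
  /-- the edges over each edge of `G` form a matching -/
  matching : ∀ x y z, graph.Adj x y → graph.Adj x z → y.1 = z.1 → y = z

namespace DPCover

variable {V : Type*} {G : SimpleGraph V} {Γ : Type*}

/-- `H` is a `k`-cover: every list has exactly `k` colors. -/
def IsKCover (H : DPCover G Γ) (k : ℕ) : Prop :=
  ∀ v, (H.list v).card = k

/-- `f` is an `H`-coloring: colors come from the lists, and the chosen nodes are independent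
in the cover graph. -/
def IsColoring (H : DPCover G Γ) (f : V → Γ) : Prop :=
  (∀ v, f v ∈ H.list v) ∧ H.graph.IsIndepSet (Set.range fun v => (v, f v))

end DPCover

/-- Every color class of `f` has at most `m` vertices. -/
def IsBoundedColoring {V Γ : Type*} (m : ℕ) (f : V → Γ) : Prop :=
  ∀ γ, (f ⁻¹' {γ}).ncard ≤ m

/-- `f` is strongly `m`-bounded for `m = ⌈|V| / k⌉`: it is `m`-bounded, and at most `|V| mod k`
color classes are large, that is, have exactly `⌊|V| / k⌋ + 1` vertices. -/
def IsStronglyBoundedColoring {V Γ : Type*} (k : ℕ) (f : V → Γ) : Prop :=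
  IsBoundedColoring ⌈(Nat.card V : ℚ) / k⌉₊ f ∧
    {γ | (f ⁻¹' {γ}).ncard = Nat.card V / k + 1}.ncard ≤ Nat.card V % k

/-- The finite graph `G` is strongly equitably DP `k`-colorable: for every `k`-cover `H` of `G`,
over any set `Γ` of colors, there is a strongly `⌈|V| / k⌉`-bounded `H`-coloring of `G`. -/
def StronglyEquitablyDPColorable {V : Type*} [Finite V] (G : SimpleGraph V) (k : ℕ) : Prop :=
  ∀ (Γ : Type w) (H : DPCover G Γ), H.IsKCover k →
    ∃ f : V → Γ, H.IsColoring f ∧ IsStronglyBoundedColoring k f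

open Finset

/-! The proof is an induction that removes `k` vertices at a time. Given a coloring of an inner
segment, `k - 1` vertices are prepended and one is appended, all with pairwise distinct colors.
Every class then grows by at most one, while `n / k` grows by exactly one and `n % k` is unchanged,
so the set `D` of possibly large classes is kept (`EquitablyColorable.extend`). Segments shorter
than `k` are colored injectively.

The induction avoids only `n = k = 3`, so `n = 6`, `k = 3` needs a direct argument (`sixColorable`).
If three consecutive middle vertices can be colored distinctly, the other three can be as well.
Otherwise the four inner lists coincide and the matchings between them are so rigid that explicit
colorings work. -/

section PathCover

variable {Γ : Type*}

/-! ### Distinct choices from lists under a matching -/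

/-- Each element is related to at most one element on either side. -/
def IsMatchingRel (M : Γ → Γ → Prop) : Prop :=
  (∀ a a' c, M a c → M a' c → a = a') ∧ ∀ a c c', M a c → M a c' → c = c'

lemma IsMatchingRel.swap {M : Γ → Γ → Prop} (h : IsMatchingRel M) :
    IsMatchingRel fun a b => M b a :=
  ⟨fun a a' c h₁ h₂ => h.2 c a a' h₁ h₂, fun a c c' h₁ h₂ => h.1 c c' a h₁ h₂⟩

/-- On failure, every `a ≠ b` forces `C` to consist of `a`, `b` and the partner of `a`. Hence each
`a` has only one `b ≠ a` in `B` (`two`). So two elements of `A` both lie in `B`, and exchanging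
their roles would give them the same partner (`swapped`). -/
lemma exists_rainbow_triple {M : Γ → Γ → Prop} (hM : IsMatchingRel M) {A B C : Finset Γ}
    (hA : 2 ≤ #A) (hB : 2 ≤ #B) (hC : 3 ≤ #C) :
    ∃ a ∈ A, ∃ b ∈ B, ∃ c ∈ C, a ≠ b ∧ c ≠ a ∧ c ≠ b ∧ ¬ M a c := by
  obtain ⟨h1, h2⟩ := hM
  obtain ⟨a, ha, a', ha', haa⟩ := one_lt_card.1 hA
  obtain ⟨b, hb, b', hb', hbb⟩ := one_lt_card.1 hB
  obtain ⟨c, c', c'', hc, hc', hc'', hcc⟩ := two_lt_card_iff.1 hC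
  by_contra! h
  have key : ∀ x ∈ A, ∀ y ∈ B, x ≠ y → ∀ z ∈ C, z = x ∨ z = y ∨ M x z := by
    intro x hx y hy hxy z hz
    have := h x hx y hy z hz hxy
    tauto
  have two : ∀ x ∈ A, ∀ y ∈ B, ∀ y' ∈ B, y ≠ y' → x ≠ y → x ≠ y' → False := by
    intro x hx y hy y' hy' hyy hxy hxy'
    have k1 := key x hx y hy hxy
    have k2 := key x hx y' hy' hxy'
    clear h key
    grind
  have swapped : ∀ x y, x ≠ y → x ∈ A → y ∈ A → x ∈ B → y ∈ B → False := by
    intro x y hxy hx hy hx' hy'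
    have k1 := key x hx y hy' hxy
    have k2 := key y hy x hx' hxy.symm
    clear h key two
    grind
  have t1 := two a ha b hb b' hb' hbb
  have t2 := two a' ha' b hb b' hb' hbb
  have t3 := swapped a a' haa ha ha'
  clear h key two swapped h1 h2 hA hB hC
  by_cases e1 : a = b <;> by_cases e2 : a = b' <;> by_cases e3 : a' = b <;>
    by_cases e4 : a' = b' <;> simp_all

lemma exists_subset_avoiding {L : Finset Γ} (I : Finset ℕ) (f : ℕ → Γ) {n : ℕ}
    (h : #I + n ≤ #L) : ∃ L' ⊆ L, n ≤ #L' ∧ ∀ x ∈ L', ∀ i ∈ I, f i ≠ x := by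
  classical
  refine ⟨L \ I.image f, sdiff_subset, ?_, ?_⟩
  · have h1 := le_card_sdiff (I.image f) L
    have h2 : #(I.image f) ≤ #I := card_image_le
    omega
  · intro x hx i hi he
    exact (mem_sdiff.1 hx).2 (mem_image.2 ⟨i, hi, he⟩)

lemma exists_subset_avoiding_not {L : Finset Γ} (I : Finset ℕ) (f : ℕ → Γ) {F : Γ → Prop}
    (hF : ∀ x y, F x → F y → x = y) {n : ℕ} (h : #I + 1 + n ≤ #L) :
    ∃ L' ⊆ L, n ≤ #L' ∧ ∀ x ∈ L', (∀ i ∈ I, f i ≠ x) ∧ ¬ F x := by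
  classical
  obtain ⟨L', hL, hc, ha⟩ := exists_subset_avoiding I f (n := n + 1) (L := L) (by omega)
  by_cases hx : ∃ x, F x
  · obtain ⟨x₀, hx₀⟩ := hx
    refine ⟨L'.erase x₀, (erase_subset _ _).trans hL, ?_, ?_⟩
    · have := pred_card_le_card_erase (s := L') (a := x₀)
      omega
    · intro x hx
      rw [mem_erase] at hx
      exact ⟨ha x hx.2, fun hFx => hx.1 (hF _ _ hFx hx₀)⟩
  · push Not at hx
    exact ⟨L', hL, by omega, fun x h' => ⟨ha x h', hx x⟩⟩

/-! ### Rainbow segments and the inductive step -/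

/-- Along a path, fewer than `k` consecutive vertices preceding a colored part can be colored
with distinct colors. -/
lemma exists_rainbow_segment {k : ℕ} {L : ℕ → Finset Γ} (hL : ∀ i, #(L i) = k)
    {R : ℕ → Γ → Γ → Prop} (hR : ∀ i, IsMatchingRel (R i)) (g : ℕ → Γ) (r p : ℕ) (hr : r < k) :
    ∃ f : ℕ → Γ, (∀ i, p + r ≤ i → f i = g i) ∧ (∀ i, p ≤ i → i < p + r → f i ∈ L i) ∧
      (∀ i, p ≤ i → i < p + r → ¬ R i (f i) (f (i + 1))) ∧
      (∀ i j, p ≤ i → i < p + r → p ≤ j → j < p + r → f i = f j → i = j) := by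
  induction r generalizing p with
  | zero => exact ⟨g, fun _ _ => rfl, by intros; omega, by intros; omega, by intros; omega⟩
  | succ r ih =>
    obtain ⟨f, h1, h2, h3, h4⟩ := ih (p + 1) (by omega)
    -- The `r` later colors and one matched color are excluded; `r + 1 < k` leaves a choice.
    obtain ⟨L', hL', hc, ha⟩ := exists_subset_avoiding_not (L := L p) (Ico (p + 1) (p + 1 + r)) f
      (F := fun x => R p x (f (p + 1))) (fun x y hx hy => (hR p).1 _ _ _ hx hy) (n := 1)
      (by rw [hL, Nat.card_Ico]; omega)
    obtain ⟨x, hx⟩ := card_pos.1 hc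
    obtain ⟨hxI, hxF⟩ := ha x hx
    have hxL := hL' hx
    simp only [mem_Ico] at hxI
    refine ⟨fun i => if i = p then x else f i, ?_, ?_, ?_, ?_⟩
    · intro i hi
      dsimp only
      rw [if_neg (by omega)]
      exact h1 i (by omega)
    · intro i hi hi'
      dsimp only
      split_ifs with h
      · rwa [h]
      · exact h2 i (by omega) (by omega)
    · intro i hi hi'
      simp only [if_neg (show i + 1 ≠ p by omega)]
      split_ifs with h
      · rwa [h]
      · exact h3 i (by omega) (by omega)
    · intro i j hi hi' hj hj' he
      dsimp only at he
      split_ifs at he with h h' h'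
      · omega
      · exact (hxI j (by omega) he.symm).elim
      · exact (hxI i (by omega) he).elim
      · exact h4 i j (by omega) (by omega) (by omega) (by omega) he

/-- The vertices `s, …, s + n - 1` of a path with lists `L` and conflict relations `R` have a
proper coloring whose color classes have at most `n / k` vertices, except for at most `n % k`
classes with `n / k + 1` vertices. -/
def EquitablyColorable (L : ℕ → Finset Γ) (R : ℕ → Γ → Γ → Prop) (k s n : ℕ) : Prop :=
  ∃ f : ℕ → Γ, (∀ i, s ≤ i → i < s + n → f i ∈ L i) ∧
    (∀ i, s ≤ i → i + 1 < s + n → ¬ R i (f i) (f (i + 1))) ∧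
    ∃ D : Finset Γ, #D ≤ n % k ∧ ∀ γ, ∃ e ≤ 1, (γ ∉ D → e = 0) ∧
      Set.ncard {i | (s ≤ i ∧ i < s + n) ∧ f i = γ} ≤ n / k + e

lemma equitablyColorable_of_lt {k : ℕ} {L : ℕ → Finset Γ} (hL : ∀ i, #(L i) = k)
    {R : ℕ → Γ → Γ → Prop} (hR : ∀ i, IsMatchingRel (R i)) (s n : ℕ) (hn : n < k) :
    EquitablyColorable L R k s n := by
  classical
  obtain ⟨c, -⟩ := card_pos.1 (by rw [hL 0]; omega : 0 < #(L 0))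
  obtain ⟨f, -, h2, h3, h4⟩ := exists_rainbow_segment hL hR (fun _ => c) n s hn
  refine ⟨f, h2, fun i hi hi' => h3 i hi (by omega), (Ico s (s + n)).image f, ?_, fun γ => ?_⟩
  · rw [Nat.mod_eq_of_lt hn]
    exact card_image_le.trans (by simp)
  · by_cases hγ : γ ∈ (Ico s (s + n)).image f
    · refine ⟨1, le_rfl, fun h => (h hγ).elim, ?_⟩
      refine le_trans ?_ (Nat.le_add_left _ _)
      refine (Set.ncard_le_one ((Set.finite_Ico s (s + n)).subset fun i hi => hi.1)).2 ?_
      rintro i ⟨hi, hi'⟩ j ⟨hj, hj'⟩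
      exact h4 i j hi.1 hi.2 hj.1 hj.2 (hi'.trans hj'.symm)
    · refine ⟨0, by omega, fun _ => rfl, ?_⟩
      have : {i | (s ≤ i ∧ i < s + n) ∧ f i = γ} = ∅ := by
        ext i
        simp only [Set.mem_ofPred_eq, Set.mem_empty_iff_false, iff_false]
        rintro ⟨hi, rfl⟩
        exact hγ (mem_image_of_mem _ (by simpa using hi))
      simp [this]

/-- The vertices `s + 2, …, s + k - 2` are colored greedily, leaving three colors at `s` and two at
both `s + 1` and the appended vertex, as `exists_rainbow_triple` requires. The bound `4 ≤ k + m`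
keeps the appended vertex from being adjacent to `s + 1`. -/
lemma EquitablyColorable.extend {k : ℕ} {L : ℕ → Finset Γ} (hL : ∀ i, #(L i) = k)
    {R : ℕ → Γ → Γ → Prop} (hR : ∀ i, IsMatchingRel (R i)) (s m : ℕ) (hk : 3 ≤ k)
    (hkm : 4 ≤ k + m) (h : EquitablyColorable L R k (s + (k - 1)) m) :
    EquitablyColorable L R k s (m + k) := by
  obtain ⟨g, g1, g2, D, hD, g3⟩ := h
  obtain ⟨f, f1, f2, f3, f4⟩ := exists_rainbow_segment hL hR g (k - 3) (s + 2) (by omega)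
  rw [show s + 2 + (k - 3) = s + (k - 1) by omega] at f1 f2 f3 f4
  obtain ⟨e, he⟩ : ∃ e, e + 1 = s + (k - 1) + m := ⟨s + (k - 1) + m - 1, by omega⟩
  set I := Ico (s + 2) (s + (k - 1)) with hI
  have hIc : #I = k - 3 := by rw [hI, Nat.card_Ico]; omega
  obtain ⟨A, hAL, hA, hA'⟩ := exists_subset_avoiding_not (L := L (s + 1)) I f
    (F := fun x => R (s + 1) x (f (s + 2))) (fun x y hx hy => (hR _).1 _ _ _ hx hy) (n := 2)
    (by rw [hL]; omega)
  obtain ⟨B, hBL, hB, hB'⟩ := exists_subset_avoiding_not (L := L (e + 1)) I f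
    (F := fun x => R e (f e) x) (fun x y hx hy => (hR _).2 _ _ _ hx hy) (n := 2)
    (by rw [hL]; omega)
  obtain ⟨C, hCL, hC, hC'⟩ := exists_subset_avoiding (L := L s) I f (n := 3)
    (by rw [hL]; omega)
  obtain ⟨a, ha, b, hb, c, hc, hab, hca, hcb, hM⟩ :=
    exists_rainbow_triple (hR s).swap hA hB hC
  obtain ⟨haI, haR⟩ := hA' a ha
  obtain ⟨hbI, hbR⟩ := hB' b hb
  have hcI := hC' c hc
  simp only [hI, mem_Ico] at haI hbI hcI
  set h : ℕ → Γ := fun i => if i = s then c else if i = s + 1 then a else if i = e + 1 then b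
    else f i with hh
  have h_s : h s = c := by simp [hh]
  have h_s1 : h (s + 1) = a := by simp [hh]
  have h_e : h (e + 1) = b := by
    rw [hh]
    dsimp only
    rw [if_neg (by omega), if_neg (by omega), if_pos rfl]
  have h_f : ∀ i, s + 2 ≤ i → i ≠ e + 1 → h i = f i := by
    intro i hi hi'
    simp only [hh]
    rw [if_neg (by omega), if_neg (by omega), if_neg hi']
  have h_g : ∀ i, s + (k - 1) ≤ i → i ≠ e + 1 → h i = g i := by
    intro i hi hi'
    rw [h_f i (by omega) hi', f1 i hi]
  clear_value h
  refine ⟨h, ?_, ?_, D, ?_, ?_⟩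
  · intro i hi hi'
    by_cases i1 : i = s
    · rw [i1, h_s]; exact hCL hc
    by_cases i2 : i = s + 1
    · rw [i2, h_s1]; exact hAL ha
    by_cases i3 : i = e + 1
    · rw [i3, h_e]; exact hBL hb
    by_cases i4 : i < s + (k - 1)
    · rw [h_f i (by omega) i3]; exact f2 i (by omega) i4
    · rw [h_g i (by omega) i3]; exact g1 i (by omega) (by omega)
  · intro i hi hi'
    by_cases i1 : i = s
    · rw [i1, h_s, h_s1]; exact hM
    by_cases i2 : i = s + 1
    · rw [i2, h_s1, h_f _ (by omega) (by omega)]; exact haR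
    by_cases i3 : i = e
    · rw [i3, h_e, h_f _ (by omega) (by omega)]; exact hbR
    rw [h_f i (by omega) (by omega), h_f (i + 1) (by omega) (by omega)]
    by_cases i4 : i < s + (k - 1)
    · exact f3 i (by omega) i4
    · rw [f1 i (by omega), f1 (i + 1) (by omega)]
      exact g2 i (by omega) (by omega)
  · rwa [Nat.add_mod_right]
  · intro γ
    obtain ⟨ε, h1, h2, h3⟩ := g3 γ
    refine ⟨ε, h1, h2, ?_⟩
    rw [Nat.add_div_right m (by omega)]
    have hsub : {i | (s ≤ i ∧ i < s + (m + k)) ∧ h i = γ} ⊆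
        {i | (s + (k - 1) ≤ i ∧ i < s + (k - 1) + m) ∧ g i = γ} ∪
        {i | ((s ≤ i ∧ i < s + (k - 1)) ∨ i = e + 1) ∧ h i = γ} := by
      rintro i ⟨hi, hi'⟩
      by_cases hi2 : (s ≤ i ∧ i < s + (k - 1)) ∨ i = e + 1
      · exact Or.inr ⟨hi2, hi'⟩
      · exact Or.inl ⟨by omega, by rw [← h_g i (by omega) (by omega), hi']⟩
    have hsing : {i | ((s ≤ i ∧ i < s + (k - 1)) ∨ i = e + 1) ∧ h i = γ}.Subsingleton := by
      have cases_of : ∀ i, ((s ≤ i ∧ i < s + (k - 1)) ∨ i = e + 1) →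
          i = s ∨ i = s + 1 ∨ i = e + 1 ∨ (s + 2 ≤ i ∧ i < s + (k - 1) ∧ h i = f i) := by
        intro i hi
        by_cases i3 : i = e + 1
        · simp [i3]
        · have := h_f i
          grind
      rintro i ⟨hi, hi'⟩ j ⟨hj, hj'⟩
      have hij := hi'.trans hj'.symm
      rcases cases_of i hi with rfl | rfl | rfl | ⟨i1, i2, i3⟩ <;>
        rcases cases_of j hj with rfl | rfl | rfl | ⟨j1, j2, j3⟩ <;> grind
    refine (Set.ncard_le_ncard hsub ?_).trans ((Set.ncard_union_le _ _).trans ?_)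
    · refine Set.Finite.union ?_ hsing.finite
      exact (Set.finite_Ico (s + (k - 1)) (s + (k - 1) + m)).subset fun i hi => hi.1
    · have := (Set.ncard_le_one hsing.finite).2 fun i hi j hj => hsing hi hj
      omega

/-! ### Six vertices with lists of size three -/

/-- A list of three colors with `c` and at most one further color forbidden: either two colors
remain, or exactly one does and `c` belongs to the list. -/
lemma exists_two_or_eq {L : Finset Γ} (hL : #L = 3) (c : Γ) {F : Γ → Prop}
    (hF : ∀ x y, F x → F y → x = y) :
    (∃ u ∈ L, ∃ v ∈ L, u ≠ v ∧ u ≠ c ∧ v ≠ c ∧ ¬ F u ∧ ¬ F v) ∨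
      ∃ y ∈ L, ∃ u ∈ L, c ∈ L ∧ (∀ x ∈ L, x = c ∨ x = y ∨ x = u) ∧
        y ≠ c ∧ u ≠ c ∧ u ≠ y ∧ F y ∧ ¬ F u ∧ ¬ F c := by
  classical
  obtain ⟨p, q, r, hpq, hpr, hqr, rfl⟩ := card_eq_three.1 hL
  have h1 := hF p q
  have h2 := hF p r
  have h3 := hF q r
  clear hF hL
  simp only [mem_insert, mem_singleton, exists_eq_or_imp, exists_eq_left, forall_eq_or_imp,
    forall_eq]
  grind (splits := 40)

/-- For fixed `m`, distinct choices exist in `A` and `B` unless both retain the same single color,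
which forces `m` into both lists. Over all `m` this makes the lists equal, and then the two partners
of `m` agree. -/
lemma rainbow_or_eq {A B M : Finset Γ} (hA : #A = 3) (hB : #B = 3) (hM : #M = 3)
    {P Q : Γ → Γ → Prop} (hP : IsMatchingRel P) (hQ : IsMatchingRel Q) :
    (∃ m ∈ M, ∃ a ∈ A, ∃ b ∈ B, m ≠ a ∧ m ≠ b ∧ a ≠ b ∧ ¬ P m a ∧ ¬ Q m b) ∨
      A = M ∧ B = M ∧ ∀ m ∈ M, ∃ a ∈ M, a ≠ m ∧ P m a ∧ Q m a := by
  rw [or_iff_not_imp_left]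
  intro h
  push Not at h
  have key : ∀ m ∈ M, m ∈ A ∧ m ∈ B ∧ ∃ a ∈ A, a ≠ m ∧ P m a ∧ (a ∈ B → Q m a) := by
    intro m hm
    have hm' := h m hm
    rcases exists_two_or_eq hA m (hP.2 m) with h1 | h1 <;>
      rcases exists_two_or_eq hB m (hQ.2 m) with h2 | h2
    · grind
    · grind
    · grind
    · grind
  have hMA : M = A := eq_of_subset_of_card_le (fun m hm => (key m hm).1) (by omega)
  have hMB : M = B := eq_of_subset_of_card_le (fun m hm => (key m hm).2.1) (by omega)
  refine ⟨hMA.symm, hMB.symm, fun m hm => ?_⟩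
  obtain ⟨-, -, a, ha, h1, h2, h3⟩ := key m hm
  rw [← hMA] at ha
  exact ⟨a, ha, h1, h2, h3 (hMB ▸ ha)⟩

/-- A proper coloring of the path on six vertices, partitioned into two parts on which it is
injective. -/
def SixColorable (L : ℕ → Finset Γ) (R : ℕ → Γ → Γ → Prop) : Prop :=
  ∃ (f : ℕ → Γ) (p : ℕ → Bool), (∀ i < 6, f i ∈ L i) ∧ (∀ i < 5, ¬ R i (f i) (f (i + 1))) ∧
    ∀ j < 6, ∀ i < j, p i = p j → f i ≠ f j

lemma SixColorable.reverse {L : ℕ → Finset Γ} {R : ℕ → Γ → Γ → Prop}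
    (h : SixColorable (fun i => L (5 - i)) (fun i x y => R (4 - i) y x)) : SixColorable L R := by
  obtain ⟨f, p, h1, h2, h3⟩ := h
  refine ⟨fun i => f (5 - i), fun i => p (5 - i), ?_, ?_, ?_⟩
  · intro i hi
    have := h1 (5 - i) (by omega)
    dsimp only at this ⊢
    rwa [show 5 - (5 - i) = i by omega] at this
  · intro i hi
    have := h2 (4 - i) (by omega)
    dsimp only at this ⊢
    rwa [show 4 - (4 - i) = i by omega, show 4 - i + 1 = 5 - i by omega,
      show 4 - i = 5 - (i + 1) by omega] at this
  · intro j hj i hi he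
    exact (h3 (5 - i) (by omega) (5 - j) (by omega) he.symm).symm

lemma SixColorable.equitablyColorable {L : ℕ → Finset Γ} {R : ℕ → Γ → Γ → Prop} {s : ℕ}
    (h : SixColorable (fun i => L (s + i)) (fun i => R (s + i))) :
    EquitablyColorable L R 3 s 6 := by
  obtain ⟨f, p, h1, h2, h3⟩ := h
  refine ⟨fun i => f (i - s), ?_, ?_, ∅, by simp, fun γ => ⟨0, by omega, fun _ => rfl, ?_⟩⟩
  · intro i hi hi'
    have := h1 (i - s) (by omega)
    dsimp only at this ⊢
    rwa [show s + (i - s) = i by omega] at this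
  · intro i hi hi'
    have := h2 (i - s) (by omega)
    dsimp only at this ⊢
    rwa [show s + (i - s) = i by omega, show i - s + 1 = i + 1 - s by omega] at this
  -- A class meets each of the two parts at most once, so it has at most `2 = 6 / 3` vertices.
  · have : Set.InjOn (fun i => p (i - s)) {i | (s ≤ i ∧ i < s + 6) ∧ f (i - s) = γ} := by
      rintro i ⟨hi, hi'⟩ j ⟨hj, hj'⟩ he
      rcases lt_trichotomy i j with hij | hij | hij
      · exact (h3 (j - s) (by omega) (i - s) (by omega) he (hi'.trans hj'.symm)).elim
      · exact hij
      · exact (h3 (i - s) (by omega) (j - s) (by omega) he.symm (hj'.trans hi'.symm)).elim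
    have := Set.ncard_le_ncard_of_injOn (t := Set.univ) _ (fun _ _ => Set.mem_univ _) this
    simpa [Set.ncard_univ] using this

/-- The parts are `{2, 3, 4}` and `{0, 1, 5}`; the vertices `1` and `5` each lose at most one color
to a matching. -/
lemma sixColorable_of_rainbow_middle {L : ℕ → Finset Γ} (hL : ∀ i, #(L i) = 3)
    {R : ℕ → Γ → Γ → Prop} (hR : ∀ i, IsMatchingRel (R i))
    (h : ∃ y ∈ L 3, ∃ x ∈ L 2, ∃ z ∈ L 4, y ≠ x ∧ y ≠ z ∧ x ≠ z ∧ ¬ R 2 x y ∧ ¬ R 3 y z) :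
    SixColorable L R := by
  obtain ⟨y, hy, x, hx, z, hz, hyx, hyz, hxz, h2, h3⟩ := h
  obtain ⟨A, hAL, hA, hA'⟩ := exists_subset_avoiding_not (L := L 1) ∅ (fun _ => x)
    (F := fun c => R 1 c x) (fun _ _ => (hR 1).1 _ _ _) (n := 2) (by simp [hL])
  obtain ⟨B, hBL, hB, hB'⟩ := exists_subset_avoiding_not (L := L 5) ∅ (fun _ => x)
    (F := fun c => R 4 z c) (fun _ _ => (hR 4).2 _ _ _) (n := 2) (by simp [hL])
  obtain ⟨a, ha, b, hb, c, hc, hab, hca, hcb, hM⟩ :=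
    exists_rainbow_triple (hR 0).swap hA hB (hL 0).ge
  have ha' := (hA' a ha).2
  have hb' := (hB' b hb).2
  have ha := hAL ha
  have hb := hBL hb
  refine ⟨fun | 0 => c | 1 => a | 2 => x | 3 => y | 4 => z | _ => b,
    fun | 0 => true | 1 => true | 5 => true | _ => false, ?_, ?_, ?_⟩
  · intro i hi
    interval_cases i <;> assumption
  · intro i hi
    interval_cases i <;> assumption
  · intro j hj i hi
    interval_cases j <;> interval_cases i <;> grind

lemma sixColorable_of_cyclic {L : ℕ → Finset Γ} (hL : ∀ i, #(L i) = 3)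
    {R : ℕ → Γ → Γ → Prop} (hR : ∀ i, IsMatchingRel (R i)) {a b c : Γ}
    (hab : a ≠ b) (hac : a ≠ c) (hbc : b ≠ c)
    (ha : ∀ i, 1 ≤ i → i < 5 → a ∈ L i) (hb : ∀ i, 1 ≤ i → i < 5 → b ∈ L i)
    (hc : ∀ i, 1 ≤ i → i < 5 → c ∈ L i)
    (h1 : R 1 a b) (h2 : R 2 c b) (h2' : R 2 a c) (h3 : R 3 b c) (h3' : R 3 c a) :
    SixColorable L R := by
  have n1 : ¬ R 1 a c := fun h => hbc ((hR 1).2 _ _ _ h1 h)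
  have n1' : ¬ R 1 a a := fun h => hab ((hR 1).2 _ _ _ h h1)
  have n2 : ¬ R 2 c c := fun h => hbc ((hR 2).2 _ _ _ h2 h)
  have n2' : ¬ R 2 a b := fun h => hbc ((hR 2).2 _ _ _ h h2')
  have n3 : ¬ R 3 c b := fun h => hab ((hR 3).2 _ _ _ h3' h)
  have n3' : ¬ R 3 b b := fun h => hbc ((hR 3).2 _ _ _ h h3)
  have ma := ha 1 (by omega) (by omega)
  have ma' := ha 2 (by omega) (by omega)
  have mb := hb 3 (by omega) (by omega)
  have mb' := hb 4 (by omega) (by omega)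
  have mc := hc 2 (by omega) (by omega)
  have mc' := hc 3 (by omega) (by omega)
  -- These cases serve the colorings `u a c c b w` and `c a a b b c`. If one end has two choices
  -- other than `c`, distinct ends exist; otherwise `c` is free at both.
  have ends : (∃ u ∈ L 0, ∃ w ∈ L 5, u ≠ w ∧ u ≠ c ∧ w ≠ c ∧ ¬ R 0 u a ∧ ¬ R 4 b w) ∨
      (c ∈ L 0 ∧ c ∈ L 5 ∧ ¬ R 0 c a ∧ ¬ R 4 b c) := by
    rcases exists_two_or_eq (hL 0) c (F := fun x => R 0 x a) (fun _ _ => (hR 0).1 _ _ _)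
      with e1 | e1 <;>
    rcases exists_two_or_eq (hL 5) c (F := fun x => R 4 b x) (fun _ _ => (hR 4).2 _ _ _)
      with e2 | e2 <;> clear * - e1 e2 <;> grind
  rcases ends with ⟨u, hu, w, hw, huw, huc, hwc, hua, hbw⟩ | ⟨hc0, hc5, hca, hbc'⟩
  · refine ⟨fun | 0 => u | 1 => a | 2 => c | 3 => c | 4 => b | _ => w, ?_⟩
    by_cases hs : u = a ∨ w = b
    · refine ⟨fun | 0 => true | 2 => true | 4 => true | _ => false, ?_, ?_, ?_⟩
      · intro i hi
        interval_cases i <;> assumption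
      · intro i hi
        interval_cases i <;> assumption
      · intro j hj i hi
        interval_cases j <;> interval_cases i <;> grind
    · refine ⟨fun | 0 => true | 1 => true | 2 => true | _ => false, ?_, ?_, ?_⟩
      · intro i hi
        interval_cases i <;> assumption
      · intro i hi
        interval_cases i <;> assumption
      · intro j hj i hi
        interval_cases j <;> interval_cases i <;> grind
  · refine ⟨fun | 0 => c | 1 => a | 2 => a | 3 => b | 4 => b | _ => c,
      fun | 0 => true | 1 => true | 3 => true | _ => false, ?_, ?_, ?_⟩
    · intro i hi
      interval_cases i <;> assumption
    · intro i hi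
      interval_cases i <;> assumption
    · intro j hj i hi
      interval_cases j <;> interval_cases i <;> grind

lemma sixColorable {L : ℕ → Finset Γ} (hL : ∀ i, #(L i) = 3)
    {R : ℕ → Γ → Γ → Prop} (hR : ∀ i, IsMatchingRel (R i)) : SixColorable L R := by
  classical
  rcases rainbow_or_eq (hL 2) (hL 4) (hL 3) (hR 2).swap (hR 3) with h | ⟨e2, e4, h34⟩
  · exact sixColorable_of_rainbow_middle hL hR h
  -- Reversing the path moves vertex `2` to position `3`.
  rcases rainbow_or_eq (hL 3) (hL 1) (hL 2) (hR 2) (hR 1).swap with h | ⟨-, e1, h21⟩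
  · exact SixColorable.reverse (sixColorable_of_rainbow_middle (fun i => hL _)
      (fun i => (hR _).swap) h)
  rw [e2] at h21 e1
  -- By `h34`, `R 3` acts on `L 3` without fixed points, hence as a 3-cycle `x → y → w → x`, and `R
  -- 2` is its inverse.
  obtain ⟨x, hx⟩ : (L 3).Nonempty := card_pos.1 (by rw [hL]; omega)
  obtain ⟨y, hy, hyx, hy2, hy3⟩ := h34 x hx
  obtain ⟨z, hz, hzy, hz2, hz3⟩ := h34 y hy
  obtain ⟨w, hw, hwx, hwy, hall⟩ :
      ∃ w ∈ L 3, w ≠ x ∧ w ≠ y ∧ ∀ v ∈ L 3, v = x ∨ v = y ∨ v = w := by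
    obtain ⟨p, q, r, hpq, hpr, hqr, he⟩ := card_eq_three.1 (hL 3)
    rw [he] at hx hy ⊢
    simp only [mem_insert, mem_singleton, exists_eq_or_imp, exists_eq_left, forall_eq_or_imp,
      forall_eq] at hx hy ⊢
    clear * - hx hy hyx hpq hpr hqr
    grind
  obtain ⟨u, hu, huw, hu2, hu3⟩ := h34 w hw
  obtain rfl : u = x := by
    rcases hall u hu with h | rfl | h
    · exact h
    · exact (hwx ((hR 3).1 _ _ _ hu3 hy3)).elim
    · exact (huw h).elim
  obtain rfl : z = w := by
    rcases hall z hz with rfl | h | h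
    · exact (hwy ((hR 3).1 _ _ _ hu3 hz3)).elim
    · exact (hzy h).elim
    · exact h
  obtain ⟨v, hv, -, hv2, hv1⟩ := h21 u hx
  obtain rfl : v = z := (hR 2).2 _ _ _ hv2 hu2
  have hLi : ∀ i, 1 ≤ i → i < 5 → L i = L 3 := by
    intro i hi hi'
    interval_cases i
    exacts [e1, e2, rfl, e4]
  exact sixColorable_of_cyclic hL hR hwx hwy hyx.symm
    (fun i hi hi' => hLi i hi hi' ▸ hw) (fun i hi hi' => hLi i hi hi' ▸ hx)
    (fun i hi hi' => hLi i hi hi' ▸ hy) hv1 hy2 hz2 hy3 hz3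

/-! ### The induction and the transfer to covers -/

/-- A path on `n` vertices is equitably colorable from lists of size `k`. -/
lemma equitablyColorable {k : ℕ} (hk : 3 ≤ k) {L : ℕ → Finset Γ} (hL : ∀ i, #(L i) = k)
    {R : ℕ → Γ → Γ → Prop} (hR : ∀ i, IsMatchingRel (R i)) (n : ℕ) :
    ∀ s, (n ≠ 3 ∨ k ≠ 3) → EquitablyColorable L R k s n := by
  induction n using Nat.strong_induction_on with
  | _ n ih =>
    intro s h
    by_cases hn : n < k
    · exact equitablyColorable_of_lt hL hR s n hn
    by_cases h6 : n = 6 ∧ k = 3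
    · obtain ⟨rfl, rfl⟩ := h6
      exact (sixColorable (fun i => hL _) (fun i => hR _)).equitablyColorable
    obtain ⟨m, rfl⟩ : ∃ m, n = m + k := ⟨n - k, by omega⟩
    exact (ih m (by omega) _ (by omega)).extend hL hR s m hk (by omega)

end PathCover
theorem corollary4p4 (t k : ℕ) (ht : t ≠ 3) (hk : 3 ≤ k) :
    StronglyEquitablyDPColorable.{w} (SimpleGraph.pathGraph t) k := by
  classical
  intro Γ H hH
  rcases Nat.eq_zero_or_pos t with rfl | hpos
  · refine ⟨Fin.elim0, ⟨fun v => v.elim0, ?_⟩, fun γ => ?_, ?_⟩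
    · rintro _ ⟨u, -⟩
      exact u.elim0
    · simp [Set.eq_empty_of_isEmpty]
    · simp [Set.eq_empty_of_isEmpty]
  -- Beyond the path the last list is repeated, so every list has size `k`.
  let L : ℕ → Finset Γ := fun i => H.list ⟨min i (t - 1), by omega⟩
  let R : ℕ → Γ → Γ → Prop := fun i x y =>
    ∃ h : i + 1 < t, H.graph.Adj (⟨i, by omega⟩, x) (⟨i + 1, h⟩, y)
  have hR : ∀ i, IsMatchingRel (R i) := by
    refine fun i => ⟨?_, ?_⟩
    · rintro a a' c ⟨h, h1⟩ ⟨_, h2⟩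
      simpa using H.matching _ _ _ h1.symm h2.symm rfl
    · rintro a c c' ⟨h, h1⟩ ⟨_, h2⟩
      simpa using H.matching _ _ _ h1 h2 rfl
  obtain ⟨f, h1, h2, D, hD, h3⟩ := equitablyColorable hk (L := L) (fun i => hH _) hR t 0
    (Or.inl ht)
  have hc : ∀ γ, ((fun v : Fin t => f v) ⁻¹' {γ}).ncard =
      Set.ncard {i | (0 ≤ i ∧ i < 0 + t) ∧ f i = γ} := by
    intro γ
    rw [← Set.ncard_image_of_injective _ Fin.val_injective]
    congr 1
    ext i
    simp only [Set.mem_image, Set.mem_preimage, Set.mem_singleton_iff, Set.mem_ofPred_eq]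
    constructor
    · rintro ⟨v, hv, rfl⟩
      exact ⟨⟨by omega, by omega⟩, hv⟩
    · rintro ⟨hi, hi'⟩
      exact ⟨⟨i, by omega⟩, hi', rfl⟩
  refine ⟨fun v => f v, ⟨fun v => ?_, ?_⟩, fun γ => ?_, ?_⟩
  · have := h1 v (by omega) (by omega)
    have hv : (⟨min v (t - 1), by omega⟩ : Fin t) = v := by
      ext
      simp only
      omega
    simpa only [L, hv] using this
  · have key : ∀ u v : Fin t, u.1 + 1 = v.1 → ¬ H.graph.Adj (u, f u) (v, f v) := by
      rintro ⟨u, hu⟩ ⟨v, hv⟩ (rfl : u + 1 = v) hadj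
      exact h2 u (by omega) (by omega) ⟨hv, hadj⟩
    rintro _ ⟨u, rfl⟩ _ ⟨v, rfl⟩ - hadj
    have := H.adj_base _ _ hadj
    rw [SimpleGraph.pathGraph_adj] at this
    rcases this with h | h
    · exact key u v h hadj
    · exact key v u h hadj.symm
  · rw [hc, Nat.card_fin]
    obtain ⟨e, he, heD, h⟩ := h3 γ
    refine h.trans ?_
    have hceil : t ≤ ⌈(t : ℚ) / k⌉₊ * k := by
      have := (div_le_iff₀ (by positivity : (0 : ℚ) < k)).1 (Nat.le_ceil ((t : ℚ) / k))
      exact_mod_cast this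
    have hmod := Nat.div_add_mod' t k
    by_cases hγ : γ ∈ D
    · have hpos := card_pos.2 ⟨γ, hγ⟩
      -- A nonempty `D` means `t % k > 0`, so the ceiling exceeds the floor.
      have : t / k < ⌈(t : ℚ) / k⌉₊ := Nat.lt_of_mul_lt_mul_right (a := k) (by omega)
      omega
    · rw [heD hγ, add_zero]
      exact Nat.div_le_of_le_mul (by rwa [mul_comm])
  · simp only [hc, Nat.card_fin]
    refine (Set.ncard_le_ncard (t := (D : Set Γ)) ?_ D.finite_toSet).trans
      ((Set.ncard_coe_finset D).trans_le hD)
    intro γ hγ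
    by_contra hn
    obtain ⟨e, he, heD, h⟩ := h3 γ
    have := heD (by simpa using hn)
    simp only [Set.mem_ofPred_eq] at hγ
    omega
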